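/- Let $[X:\mathcal R]$ be an inverse monoid presentation, with $\mathcal R \subseteq A^*\times A^*$, $A = X\sqcup X^{-1}$, and let $\theta: \operatorname{FIM}(X)\to M$ be the presentation map from the free inverse monoid onto the inverse monoid $M$ that it presents. Let $\theta_{\min}$ be the smallest congruence on $\operatorname{FIM}(X)$ with the same restriction to idempotents as the kernel congruence of $\theta$, let $\mathcal T = \operatorname{FIM}(X)/\theta_{\min}$, and for $w\in A^*$ write $\bar w$ for its image in $\mathcal T$. The Squier complex $\operatorname{Sq}$ is the $2$-complex with vertex set $\mathcal T$, with an edge $(p,l,r,q)$ from $p\bar l q$ to $p\bar r q$ for all $p,q\in\mathcal T$, $(l,r)\in\mathcal R$, and with, for all $p,v,u\in\mathcal T$ and $(l,r),(s,d)\in\mathcal R$, a $2$-cell that makes the edge paths $(p,l,r,v\bar s u)\circ(p\bar r v,s,d,u)$ and $(p\bar l v,s,d,u)\circ(p,l,r,v\bar d u)$ homotopic. Let $\pi$ be its fundamental groupoid with vertex set $\mathcal T$ (composition $\circ$ in diagrammatic order, $\alpha$ going from $\alpha\mathbf d$ to $\alpha\mathbf r$). The monoid $\mathcal T$ acts on both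 sides of $\pi$ by $t\rhd(p,l,r,q)=(tp,l,r,q)$, $(p,l,r,q)\lhd t=(p,l,r,qt)$, and $\alpha * \beta = (\alpha\lhd\beta\mathbf d)\circ(\alpha\mathbf r\rhd\beta)$. For an idempotent $e\in\mathcal T$ put $\operatorname{star}_e^{\bowtie}=\{e\rhd\alpha\lhd e : \alpha\in\pi,\ \alpha\mathbf d=e\}$, which is a group under $*$, and let $\Sigma_e^{\bowtie}$ be the set of homotopy classes of single edges that lie in $\operatorname{star}_e^{\bowtie}$. For $q\in\mathcal T$ and $(l,r)\in\mathcal R$ with $e\leqslant q^{-1}\,\overline{l^{-1}l}\,q$ in the natural partial order, set $\lambda^e_{l,r,q}=(e q^{-1}\overline{l^{-1}},\,l,\,r,\,qe)$, an edge that starts at $e$. Proposition. For every idempotent $e\in\mathcal T$, $\Sigma_e^{\bowtie}$ is the set of the homotopy classes of the edges $\lambda^e_{l,r,q}$, it generates the group $(\operatorname{star}_e^{\bowtie},*)$, and $$\lambda^e_{l,r,v\bar s u} * \lambda^e_{s,d,u} = \lambda^e_{s,d,u} * \lambda^e_{l,r,v\bar d u}$$ (for all $(l,r),(s,d)\in\mathcal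 R$ and $u,v\in\mathcal T$ for which these three edges are defined) is a set of defining relations for it on the generating set $\Sigma_e^{\bowtie}$. The same relations also present the group when one takes one generator for each edge of the form $\lambda^e_{l,r,q}$ instead of one for each homotopy class. The two sides of each such relation are the homotopy classes of the two edge paths, starting at $e$, that bound a $2$-cell of $\operatorname{Sq}$ with the same relations $(l,r),(s,d)$, the same $v$, and with $ue$ as right-hand factor. -/

import Mathlib

/-! ## Inverse monoids -/

/-- An inverse monoid: a monoid in which every element `a` has a unique inverse `a⁻¹`, that is, a
unique `b` with `a * b * a = a` and `b * a * b = b`. -/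
class InverseMonoid (S : Type*) extends Monoid S, Inv S where
  mul_inv_mul : ∀ a : S, a * a⁻¹ * a = a
  inv_mul_inv : ∀ a : S, a⁻¹ * a * a⁻¹ = a⁻¹
  inv_unique : ∀ a b : S, a * b * a = a → b * a * b = b → b = a⁻¹

namespace InverseMonoid

theorem idem_inv {S : Type*} [InverseMonoid S] {e : S} (he : e * e = e) : e⁻¹ = e :=
  (inv_unique e e (by rw [he, he]) (by rw [he, he])).symm

theorem inv_invol {S : Type*} [InverseMonoid S] (a : S) : (a⁻¹)⁻¹ = a :=
  (inv_unique a⁻¹ a (inv_mul_inv a) (mul_inv_mul a)).symm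

theorem mul_inv_idem {S : Type*} [InverseMonoid S] (a : S) :
    (a * a⁻¹) * (a * a⁻¹) = a * a⁻¹ := by
  rw [← mul_assoc, mul_inv_mul]

theorem inv_mul_idem {S : Type*} [InverseMonoid S] (a : S) :
    (a⁻¹ * a) * (a⁻¹ * a) = a⁻¹ * a := by
  rw [← mul_assoc, inv_mul_inv]

theorem idem_mul_idem {S : Type*} [InverseMonoid S] {e f : S} (he : e * e = e) (hf : f * f = f) :
    (e * f) * (e * f) = e * f := by
  have h1 := mul_inv_mul (e * f)
  have h2 := inv_mul_inv (e * f)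
  set x := (e * f)⁻¹ with hx
  have h3 : f * x * e = x := by
    refine inv_unique (e * f) _ ?_ ?_
    · calc e * f * (f * x * e) * (e * f) = e * (f * f) * x * (e * e) * f := by
            simp only [mul_assoc]
        _ = (e * f) * x * (e * f) := by rw [he, hf]; simp only [mul_assoc]
        _ = e * f := h1
    · calc f * x * e * (e * f) * (f * x * e) = f * (x * ((e * e) * (f * f)) * x) * e := by
            simp only [mul_assoc]
        _ = f * x * e := by rw [he, hf, h2]
  have h4 : x * x = x := by
    calc x * x = (f * x * e) * (f * x * e) := by rw [h3]
      _ = f * (x * (e * f) * x) * e := by simp only [mul_assoc]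
      _ = x := by rw [h2, h3]
  have h5 : e * f = x := by
    rw [← inv_invol (e * f), ← hx, idem_inv h4]
  rw [h5, h4]

theorem idem_comm {S : Type*} [InverseMonoid S] {e f : S} (he : e * e = e) (hf : f * f = f) :
    e * f = f * e := by
  have h1 := idem_mul_idem he hf
  have h2 := idem_mul_idem hf he
  have h3 : f * e = (e * f)⁻¹ := by
    refine inv_unique _ _ ?_ ?_
    · calc e * f * (f * e) * (e * f) = e * (f * f) * (e * e) * f := by simp only [mul_assoc]
        _ = (e * f) * (e * f) := by rw [he, hf]; simp only [mul_assoc]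
        _ = e * f := h1
    · calc f * e * (e * f) * (f * e) = f * (e * e) * (f * f) * e := by simp only [mul_assoc]
        _ = (f * e) * (f * e) := by rw [he, hf]; simp only [mul_assoc]
        _ = f * e := h2
  rw [h3, idem_inv h1]

theorem mul_inv_reverse {S : Type*} [InverseMonoid S] (a b : S) : (a * b)⁻¹ = b⁻¹ * a⁻¹ := by
  have hc := idem_comm (mul_inv_idem b) (inv_mul_idem a)
  refine (inv_unique _ _ ?_ ?_).symm
  · calc a * b * (b⁻¹ * a⁻¹) * (a * b) = a * ((b * b⁻¹) * (a⁻¹ * a)) * b := by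
          simp only [mul_assoc]
      _ = (a * a⁻¹ * a) * (b * b⁻¹ * b) := by rw [hc]; simp only [mul_assoc]
      _ = a * b := by rw [mul_inv_mul, mul_inv_mul]
  · calc b⁻¹ * a⁻¹ * (a * b) * (b⁻¹ * a⁻¹) = b⁻¹ * ((a⁻¹ * a) * (b * b⁻¹)) * a⁻¹ := by
          simp only [mul_assoc]
      _ = (b⁻¹ * b * b⁻¹) * (a⁻¹ * a * a⁻¹) := by rw [← hc]; simp only [mul_assoc]
      _ = b⁻¹ * a⁻¹ := by rw [inv_mul_inv, inv_mul_inv]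

/-- A monoid with an involutive anti-automorphism `a ↦ a⁻¹` such that `a a⁻¹ a = a` and such that
the elements `a a⁻¹` commute with each other is an inverse monoid. -/
theorem unique_of_laws {S : Type*} [Monoid S] [Inv S] (h1 : ∀ a : S, a * a⁻¹ * a = a)
    (h2 : ∀ a : S, (a⁻¹)⁻¹ = a)
    (h4 : ∀ a b : S, (a * a⁻¹) * (b * b⁻¹) = (b * b⁻¹) * (a * a⁻¹)) (a b : S)
    (hab : a * b * a = a) (hba : b * a * b = b) : b = a⁻¹ := by
  have h1' : ∀ a : S, a⁻¹ * a * a⁻¹ = a⁻¹ := fun a => by simpa [h2] using h1 a⁻¹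
  have h4' : ∀ a b : S, (a⁻¹ * a) * (b * b⁻¹) = (b * b⁻¹) * (a⁻¹ * a) := fun a b => by
    simpa [h2] using h4 a⁻¹ b
  have hself : ∀ x : S, x * x = x → x * x⁻¹ = x := by
    intro x hx
    have e1 : x⁻¹ = (x * x⁻¹) * (x⁻¹ * x) := by
      calc x⁻¹ = x⁻¹ * (x * x) * x⁻¹ := by rw [hx, h1']
        _ = (x⁻¹ * x) * (x * x⁻¹) := by simp only [mul_assoc]
        _ = _ := h4' x x
    have e3 : x⁻¹ * x⁻¹ = x⁻¹ := by
      have i1 : (x * x⁻¹) * (x * x⁻¹) = x * x⁻¹ := by rw [← mul_assoc, h1]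
      have i2 : (x⁻¹ * x) * (x⁻¹ * x) = x⁻¹ * x := by rw [← mul_assoc, h1']
      have c := h4' x x
      generalize hp : x * x⁻¹ = p at *
      generalize hq : x⁻¹ * x = q at *
      rw [e1]
      calc p * q * (p * q) = p * (q * p) * q := by simp only [mul_assoc]
        _ = (p * p) * (q * q) := by rw [c]; simp only [mul_assoc]
        _ = p * q := by rw [i1, i2]
    have e4 : x = (x⁻¹ * x) * (x * x⁻¹) := by
      calc x = x * (x⁻¹ * x⁻¹) * x := by rw [e3, h1]
        _ = (x * x⁻¹) * (x⁻¹ * x) := by simp only [mul_assoc]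
        _ = _ := (h4' x x).symm
    have e5 : x = x⁻¹ := by
      conv_lhs => rw [e4, h4' x x, ← e1]
    rw [← e5, hx]
  have hcomm : ∀ x y : S, x * x = x → y * y = y → x * y = y * x := by
    intro x y hx hy
    rw [← hself x hx, ← hself y hy, h4]
  have iab : (a * b) * (a * b) = a * b := by rw [← mul_assoc, hab]
  have iba : (b * a) * (b * a) = b * a := by rw [← mul_assoc, hba]
  have i1 : (a * a⁻¹) * (a * a⁻¹) = a * a⁻¹ := by rw [← mul_assoc, h1]
  have i2 : (a⁻¹ * a) * (a⁻¹ * a) = a⁻¹ * a := by rw [← mul_assoc, h1']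
  calc b = b * (a * a⁻¹ * a) * b := by rw [h1, hba]
    _ = (b * a) * (a⁻¹ * a) * b := by simp only [mul_assoc]
    _ = (a⁻¹ * a) * (b * a) * b := by rw [hcomm _ _ iba i2]
    _ = a⁻¹ * a * (b * a * b) := by simp only [mul_assoc]
    _ = (a⁻¹ * a * a⁻¹) * (a * b) := by rw [hba, h1', mul_assoc]
    _ = a⁻¹ * ((a * a⁻¹) * (a * b)) := by simp only [mul_assoc]
    _ = a⁻¹ * (a * b * a) * a⁻¹ := by rw [hcomm _ _ i1 iab]; simp only [mul_assoc]
    _ = a⁻¹ := by rw [hab, h1']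

/-- The natural partial order of an inverse monoid: `a ≤ b` if and only if `a = b * f` for some
idempotent `f`. -/
def NatLE {S : Type*} [InverseMonoid S] (a b : S) : Prop := ∃ f : S, f * f = f ∧ a = b * f

end InverseMonoid

open InverseMonoid

/-- A congruence on an inverse monoid is compatible with inverses. -/
theorem Con.rel_inv {S : Type*} [InverseMonoid S] (c : Con S) {a b : S} (h : c a b) :
    c a⁻¹ b⁻¹ := by
  have key : ∀ {x y : S}, c x y → c (x⁻¹ * x) (y⁻¹ * y) := by
    have half : ∀ {x y : S}, c x y → c (y⁻¹ * y) ((y⁻¹ * y) * (x⁻¹ * x)) := by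
      intro x y hxy
      have t1 : c y (y * (x⁻¹ * x)) := by
        have := c.mul hxy (c.refl (x⁻¹ * x))
        rw [← mul_assoc, mul_inv_mul] at this
        exact c.trans (c.symm hxy) this
      have := c.mul (c.refl y⁻¹) t1
      rwa [← mul_assoc y⁻¹ y] at this
    intro x y hxy
    have a1 := half hxy
    have a2 := half (c.symm hxy)
    rw [idem_comm (inv_mul_idem x) (inv_mul_idem y)] at a2
    exact c.trans a2 (c.symm a1)
  have k1 := key h
  have s1 : c a⁻¹ (b⁻¹ * b * a⁻¹) := by
    have := c.mul k1 (c.refl a⁻¹)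
    rwa [inv_mul_inv] at this
  have s2 : c (b⁻¹ * b * a⁻¹) (b⁻¹ * (a * a⁻¹)) := by
    have := c.mul (c.mul (c.refl b⁻¹) (c.symm h)) (c.refl a⁻¹)
    rwa [mul_assoc b⁻¹ a] at this
  have s3 : c (a * a⁻¹) ((a * a⁻¹) * (b * b⁻¹)) := by
    have t1 : c a ((b * b⁻¹) * a) := by
      have := c.mul (c.refl (b * b⁻¹)) h
      rw [mul_inv_mul] at this
      exact c.trans h (c.symm this)
    have := c.mul t1 (c.refl a⁻¹)
    rwa [mul_assoc (b * b⁻¹), idem_comm (mul_inv_idem b) (mul_inv_idem a)] at this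
  have s4 : c (b * b⁻¹) ((a * a⁻¹) * (b * b⁻¹)) := by
    have t1 : c b ((a * a⁻¹) * b) := by
      have := c.mul (c.refl (a * a⁻¹)) (c.symm h)
      rw [mul_inv_mul] at this
      exact c.trans (c.symm h) (c.symm this)
    have := c.mul t1 (c.refl b⁻¹)
    rwa [mul_assoc (a * a⁻¹)] at this
  have s5 := c.mul (c.refl b⁻¹) (c.trans s3 (c.symm s4))
  rw [← mul_assoc b⁻¹ b, inv_mul_inv] at s5
  exact c.trans s1 (c.trans s2 s5)

/-- The quotient of an inverse monoid by a congruence is an inverse monoid. -/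
instance Con.inverseMonoidQuotient {S : Type*} [InverseMonoid S] (c : Con S) :
    InverseMonoid c.Quotient :=
  letI : Inv c.Quotient := ⟨Quotient.map' (fun a => a⁻¹) fun _ _ h => c.rel_inv h⟩
  have h1 : ∀ a : c.Quotient, a * a⁻¹ * a = a := fun a =>
    Con.induction_on a fun x => congrArg (fun y : S => (y : c.Quotient)) (mul_inv_mul x)
  have h2 : ∀ a : c.Quotient, (a⁻¹)⁻¹ = a := fun a =>
    Con.induction_on a fun x => congrArg (fun y : S => (y : c.Quotient)) (inv_invol x)
  have h4 : ∀ a b : c.Quotient, (a * a⁻¹) * (b * b⁻¹) = (b * b⁻¹) * (a * a⁻¹) := fun a b =>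
    Con.induction_on₂ a b fun x y => congrArg (fun y : S => (y : c.Quotient))
      (idem_comm (mul_inv_idem x) (mul_inv_idem y))
  { inv := Quotient.map' (fun a => a⁻¹) fun _ _ h => c.rel_inv h
    mul_inv_mul := h1
    inv_mul_inv := fun a => (congrArg (fun z => a⁻¹ * z * a⁻¹) (h2 a).symm).trans (h1 a⁻¹)
    inv_unique := unique_of_laws h1 h2 h4 }

/-- The smallest congruence on `S` that has the same trace as `c`, that is, the same restriction
to the idempotents. (The intersection of all congruences with that trace has that trace.) -/
def Con.minTrace {S : Type*} [Monoid S] (c : Con S) : Con S :=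
  sInf {d : Con S | ∀ e f : S, e * e = e → f * f = f → (d e f ↔ c e f)}

theorem Con.minTrace_le {S : Type*} [Monoid S] (c : Con S) : c.minTrace ≤ c :=
  sInf_le fun _ _ _ _ => Iff.rfl

theorem Con.minTrace_idem {S : Type*} [Monoid S] (c : Con S) {e f : S} (he : e * e = e)
    (hf : f * f = f) (h : c e f) : c.minTrace e f := by
  intro d hd
  exact (hd e f he hf).2 h

/-! ## The free inverse monoid and the inverse monoids `M` and `T` of a presentation -/

/-- Words in the alphabet `A = X ⊔ X⁻¹`; the letter `(x, true)` is `x` and `(x, false)` is its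
formal inverse. -/
abbrev IWord (X : Type*) := FreeMonoid (X × Bool)

/-- The formal inverse of a word: reverse it and invert each letter. -/
def IWord.inv {X : Type*} (w : IWord X) : IWord X := FreeMonoid.ofList (FreeGroup.invRev w.toList)

theorem IWord.inv_inv {X : Type*} (w : IWord X) : w.inv.inv = w := by
  simp [IWord.inv]

theorem IWord.inv_mul {X : Type*} (v w : IWord X) : (v * w).inv = w.inv * v.inv := by
  simp [IWord.inv, FreeGroup.invRev_append]

/-- The pairs that generate the Wagner congruence. -/
inductive WagnerRel {X : Type*} : IWord X → IWord X → Prop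
  | regular (w : IWord X) : WagnerRel (w * w.inv * w) w
  | comm (v w : IWord X) :
      WagnerRel ((v * v.inv) * (w * w.inv)) ((w * w.inv) * (v * v.inv))

/-- The Wagner congruence on the free monoid on `X ⊔ X⁻¹`. -/
def wagnerCon (X : Type*) : Con (IWord X) := conGen WagnerRel

/-- The free inverse monoid on `X`. -/
abbrev FIM (X : Type*) := (wagnerCon X).Quotient

theorem wagnerCon_inv {X : Type*} {v w : IWord X} (h : wagnerCon X v w) :
    wagnerCon X v.inv w.inv := by
  have hh : ConGen.Rel WagnerRel v w := h
  clear h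
  induction hh with
  | of x y hr =>
    cases hr with
    | regular w =>
      refine ConGen.Rel.of _ _ ?_
      have := WagnerRel.regular y.inv
      rw [IWord.inv_inv] at this
      simpa [IWord.inv_mul, IWord.inv_inv, mul_assoc] using this
    | comm v w =>
      refine ConGen.Rel.of _ _ ?_
      have := WagnerRel.comm w v
      simpa [IWord.inv_mul, IWord.inv_inv, mul_assoc] using this
  | refl x => exact (wagnerCon X).refl _
  | symm _ ih => exact (wagnerCon X).symm ih
  | trans _ _ ih1 ih2 => exact (wagnerCon X).trans ih1 ih2
  | mul _ _ ih1 ih2 =>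
    rw [IWord.inv_mul, IWord.inv_mul]
    exact (wagnerCon X).mul ih2 ih1

instance FIM.instInverseMonoid (X : Type*) : InverseMonoid (FIM X) :=
  letI : Inv (FIM X) := ⟨Quotient.map' IWord.inv fun _ _ h => wagnerCon_inv h⟩
  have h1 : ∀ a : FIM X, a * a⁻¹ * a = a := fun a =>
    Con.induction_on a fun x => (Con.eq _).2 (ConGen.Rel.of _ _ (WagnerRel.regular x))
  have h2 : ∀ a : FIM X, (a⁻¹)⁻¹ = a := fun a =>
    Con.induction_on a fun x => congrArg (fun y : IWord X => (y : FIM X)) (IWord.inv_inv x)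
  have h4 : ∀ a b : FIM X, (a * a⁻¹) * (b * b⁻¹) = (b * b⁻¹) * (a * a⁻¹) := fun a b =>
    Con.induction_on₂ a b fun x y => (Con.eq _).2 (ConGen.Rel.of _ _ (WagnerRel.comm x y))
  { inv := Quotient.map' IWord.inv fun _ _ h => wagnerCon_inv h
    mul_inv_mul := h1
    inv_mul_inv := fun a => (congrArg (fun z => a⁻¹ * z * a⁻¹) (h2 a).symm).trans (h1 a⁻¹)
    inv_unique := unique_of_laws h1 h2 h4 }

/-- The congruence on `FIM X` generated by a set `R` of pairs of words. -/
def presCon {X : Type*} (R : Set (IWord X × IWord X)) : Con (FIM X) :=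
  conGen fun a b => ∃ lr ∈ R, a = (lr.1 : FIM X) ∧ b = (lr.2 : FIM X)

/-- The inverse monoid `M` presented by `[X : R]`; the presentation map `θ : FIM X → M` is the
quotient map. -/
abbrev PresM {X : Type*} (R : Set (IWord X × IWord X)) := (presCon R).Quotient

/-- The inverse monoid `T = T(M, X)`: the quotient of `FIM X` by the smallest congruence with the
same trace as the kernel congruence of `θ : FIM X → M`. -/
abbrev PresT {X : Type*} (R : Set (IWord X × IWord X)) := (presCon R).minTrace.Quotient

/-- The canonical map from words to `T`, through `FIM X`. -/
def toT {X : Type*} (R : Set (IWord X × IWord X)) : IWord X →* PresT R :=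
  (presCon R).minTrace.mk'.comp (wagnerCon X).mk'

/-- The canonical idempotent separating map `ψ : T → M`. -/
def psi {X : Type*} (R : Set (IWord X × IWord X)) : PresT R →* PresM R :=
  Con.map _ _ (presCon R).minTrace_le

theorem psi_inv {X : Type*} {R : Set (IWord X × IWord X)} (a : PresT R) :
    psi R a⁻¹ = (psi R a)⁻¹ :=
  Con.induction_on a fun _ => rfl

theorem psi_rel {X : Type*} {R : Set (IWord X × IWord X)} (a : R) :
    psi R (toT R a.1.1) = psi R (toT R a.1.2) :=
  (Con.eq _).2 (ConGen.Rel.of _ _ ⟨a.1, a.2, rfl, rfl⟩)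

theorem psi_idem_sep {X : Type*} {R : Set (IWord X × IWord X)} {e f : PresT R} (he : e * e = e)
    (hf : f * f = f) (h : psi R e = psi R f) : e = f := by
  induction e using Con.induction_on with | _ a
  induction f using Con.induction_on with | _ b
  have ha : ((a * a⁻¹ : FIM X) : PresT R) = (a : PresT R) := by
    change (a : PresT R) * (a : PresT R)⁻¹ = _
    rw [idem_inv he, he]
  have hb : ((b * b⁻¹ : FIM X) : PresT R) = (b : PresT R) := by
    change (b : PresT R) * (b : PresT R)⁻¹ = _
    rw [idem_inv hf, hf]
  rw [← ha, ← hb] at h ⊢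
  exact (Con.eq _).2 ((presCon R).minTrace_idem (mul_inv_idem a) (mul_inv_idem b)
    ((Con.eq _).1 h))

/-! ## The Squier complex -/

/-- An edge `(p, l, r, q)` of the Squier complex, with `p, q ∈ T` and `(l, r) ∈ R`. -/
@[ext]
structure SqEdge {X : Type*} (R : Set (IWord X × IWord X)) where
  left : PresT R
  rel : R
  right : PresT R

namespace SqEdge

variable {X : Type*} {R : Set (IWord X × IWord X)}

/-- The edge `(p, l, r, q)` starts at `p l q`. -/
def src (a : SqEdge R) : PresT R := a.left * toT R a.rel.1.1 * a.right

/-- The edge `(p, l, r, q)` ends at `p r q`. -/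
def tgt (a : SqEdge R) : PresT R := a.left * toT R a.rel.1.2 * a.right

/-- The left action `t ▷ (p, l, r, q) = (t p, l, r, q)`. -/
def lact (t : PresT R) (a : SqEdge R) : SqEdge R := ⟨t * a.left, a.rel, a.right⟩

/-- The right action `(p, l, r, q) ◁ t = (p, l, r, q t)`. -/
def ract (a : SqEdge R) (t : PresT R) : SqEdge R := ⟨a.left, a.rel, a.right * t⟩

end SqEdge

/-- An oriented edge: `(a, true)` is `a` traversed forwards, `(a, false)` backwards. -/
abbrev OEdge {X : Type*} (R : Set (IWord X × IWord X)) := SqEdge R × Bool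

namespace OEdge

variable {X : Type*} {R : Set (IWord X × IWord X)}

/-- The initial vertex of an oriented edge. -/
def src (a : OEdge R) : PresT R := if a.2 then a.1.src else a.1.tgt

/-- The terminal vertex of an oriented edge. -/
def tgt (a : OEdge R) : PresT R := if a.2 then a.1.tgt else a.1.src

/-- The same edge with the opposite orientation. -/
def flip (a : OEdge R) : OEdge R := (a.1, !a.2)

/-- The left action of `T` on oriented edges. -/
def lact (t : PresT R) (a : OEdge R) : OEdge R := (a.1.lact t, a.2)

/-- The right action of `T` on oriented edges. -/
def ract (t : PresT R) (a : OEdge R) : OEdge R := (a.1.ract t, a.2)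

theorem src_lact (t : PresT R) (a : OEdge R) : (a.lact t).src = t * a.src := by
  rcases a with ⟨a, _ | _⟩ <;> simp [src, lact, SqEdge.src, SqEdge.tgt, SqEdge.lact, mul_assoc]

theorem tgt_lact (t : PresT R) (a : OEdge R) : (a.lact t).tgt = t * a.tgt := by
  rcases a with ⟨a, _ | _⟩ <;> simp [tgt, lact, SqEdge.src, SqEdge.tgt, SqEdge.lact, mul_assoc]

theorem src_ract (t : PresT R) (a : OEdge R) : (a.ract t).src = a.src * t := by
  rcases a with ⟨a, _ | _⟩ <;> simp [src, ract, SqEdge.src, SqEdge.tgt, SqEdge.ract, mul_assoc]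

theorem tgt_ract (t : PresT R) (a : OEdge R) : (a.ract t).tgt = a.tgt * t := by
  rcases a with ⟨a, _ | _⟩ <;> simp [tgt, ract, SqEdge.src, SqEdge.tgt, SqEdge.ract, mul_assoc]

theorem src_flip (a : OEdge R) : a.flip.src = a.tgt := by
  rcases a with ⟨a, _ | _⟩ <;> simp [src, tgt, flip]

theorem tgt_flip (a : OEdge R) : a.flip.tgt = a.src := by
  rcases a with ⟨a, _ | _⟩ <;> simp [src, tgt, flip]

theorem flip_flip (a : OEdge R) : a.flip.flip = a := by
  simp [flip]

theorem lact_lact (s t : PresT R) (a : OEdge R) : (a.lact t).lact s = a.lact (s * t) := by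
  simp [lact, SqEdge.lact, mul_assoc]

theorem ract_ract (s t : PresT R) (a : OEdge R) : (a.ract s).ract t = a.ract (s * t) := by
  simp [ract, SqEdge.ract, mul_assoc]

theorem ract_lact (s t : PresT R) (a : OEdge R) : (a.lact s).ract t = (a.ract t).lact s := rfl

theorem flip_lact (t : PresT R) (a : OEdge R) : (a.lact t).flip = a.flip.lact t := rfl

theorem flip_ract (t : PresT R) (a : OEdge R) : (a.ract t).flip = a.flip.ract t := rfl

theorem psi_tgt (a : OEdge R) : psi R a.tgt = psi R a.src := by
  rcases a with ⟨a, _ | _⟩ <;> simp [src, tgt, SqEdge.src, SqEdge.tgt, psi_rel]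

end OEdge

/-- A 2-cell of the Squier complex: given by `p, v, u ∈ T` and relations `(l, r), (s, d) ∈ R`
(where `v` is the product of the two factors that stand between the two relations). -/
structure SqCell {X : Type*} (R : Set (IWord X × IWord X)) where
  left : PresT R
  rel₁ : R
  mid : PresT R
  rel₂ : R
  right : PresT R

namespace SqCell

variable {X : Type*} {R : Set (IWord X × IWord X)}

/-- The edge path `(p, l, r, v s u) ∘ (p r v, s, d, u)` from `p l v s u` to `p r v d u`. -/
def path₁ (c : SqCell R) : List (OEdge R) :=
  [(⟨c.left, c.rel₁, c.mid * toT R c.rel₂.1.1 * c.right⟩, true),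
   (⟨c.left * toT R c.rel₁.1.2 * c.mid, c.rel₂, c.right⟩, true)]

/-- The edge path `(p l v, s, d, u) ∘ (p, l, r, v d u)` from `p l v s u` to `p r v d u`. -/
def path₂ (c : SqCell R) : List (OEdge R) :=
  [(⟨c.left * toT R c.rel₁.1.1 * c.mid, c.rel₂, c.right⟩, true),
   (⟨c.left, c.rel₁, c.mid * toT R c.rel₂.1.2 * c.right⟩, true)]

end SqCell

/-- `IsPath x P y`: the list `P` of oriented edges is an edge path from `x` to `y`. -/
def IsPath {X : Type*} {R : Set (IWord X × IWord X)} (x : PresT R) :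
    List (OEdge R) → PresT R → Prop
  | [], y => x = y
  | a :: P, y => a.src = x ∧ IsPath a.tgt P y

/-- The elementary homotopies: cancellation of an edge against its reverse, and replacement of one
half of the boundary of a 2-cell by the other half. -/
inductive HomotopyStep {X : Type*} {R : Set (IWord X × IWord X)} :
    List (OEdge R) → List (OEdge R) → Prop
  | cancel (P : List (OEdge R)) (a : OEdge R) (Q : List (OEdge R)) :
      HomotopyStep (P ++ [a, a.flip] ++ Q) (P ++ Q)
  | cell (P : List (OEdge R)) (c : SqCell R) (Q : List (OEdge R)) :
      HomotopyStep (P ++ c.path₁ ++ Q) (P ++ c.path₂ ++ Q)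

/-- The arrows from `x` to `y` in the fundamental groupoid `π(Sq(P), T)`: edge paths from `x` to
`y` modulo the equivalence relation generated by the elementary homotopies. -/
def SqHom {X : Type*} {R : Set (IWord X × IWord X)} (x y : PresT R) : Type _ :=
  Quot fun P Q : {P : List (OEdge R) // IsPath x P y} => HomotopyStep P.1 Q.1

section Paths

variable {X : Type*} {R : Set (IWord X × IWord X)}

theorem IsPath.nil (x : PresT R) : IsPath x ([] : List (OEdge R)) x := rfl

theorem IsPath.append {x y z : PresT R} {P Q : List (OEdge R)} (hP : IsPath x P y)
    (hQ : IsPath y Q z) : IsPath x (P ++ Q) z := by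
  induction P generalizing x with
  | nil => cases hP; exact hQ
  | cons a P ih => exact ⟨hP.1, ih hP.2⟩

theorem IsPath.lact (t : PresT R) {x y : PresT R} {P : List (OEdge R)} (hP : IsPath x P y) :
    IsPath (t * x) (P.map (OEdge.lact t)) (t * y) := by
  induction P generalizing x with
  | nil => cases hP; rfl
  | cons a P ih =>
    exact ⟨by rw [OEdge.src_lact, hP.1], by rw [OEdge.tgt_lact]; exact ih hP.2⟩

theorem IsPath.ract (t : PresT R) {x y : PresT R} {P : List (OEdge R)} (hP : IsPath x P y) :
    IsPath (x * t) (P.map (OEdge.ract t)) (y * t) := by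
  induction P generalizing x with
  | nil => cases hP; rfl
  | cons a P ih =>
    exact ⟨by rw [OEdge.src_ract, hP.1], by rw [OEdge.tgt_ract]; exact ih hP.2⟩

/-- The reverse of a list of oriented edges. -/
def revPath (P : List (OEdge R)) : List (OEdge R) := (P.map OEdge.flip).reverse

theorem IsPath.rev {x y : PresT R} {P : List (OEdge R)} (hP : IsPath x P y) :
    IsPath y (revPath P) x := by
  induction P generalizing x with
  | nil => cases hP; rfl
  | cons a P ih =>
    have : revPath (a :: P) = revPath P ++ [a.flip] := by simp [revPath]
    rw [this]
    exact (ih hP.2).append ⟨OEdge.src_flip a, (OEdge.tgt_flip a).trans hP.1⟩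

theorem IsPath.psi_eq {x y : PresT R} {P : List (OEdge R)} (hP : IsPath x P y) :
    psi R y = psi R x := by
  induction P generalizing x with
  | nil => cases hP; rfl
  | cons a P ih => rw [ih hP.2, OEdge.psi_tgt, hP.1]

theorem HomotopyStep.append_left (L : List (OEdge R)) {P Q : List (OEdge R)}
    (h : HomotopyStep P Q) : HomotopyStep (L ++ P) (L ++ Q) := by
  cases h with
  | cancel P a Q => simpa using HomotopyStep.cancel (L ++ P) a Q
  | cell P c Q => simpa using HomotopyStep.cell (L ++ P) c Q

theorem HomotopyStep.append_right (L : List (OEdge R)) {P Q : List (OEdge R)}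
    (h : HomotopyStep P Q) : HomotopyStep (P ++ L) (Q ++ L) := by
  cases h with
  | cancel P a Q => simpa using HomotopyStep.cancel P a (Q ++ L)
  | cell P c Q => simpa using HomotopyStep.cell P c (Q ++ L)

theorem HomotopyStep.lact (t : PresT R) {P Q : List (OEdge R)} (h : HomotopyStep P Q) :
    HomotopyStep (P.map (OEdge.lact t)) (Q.map (OEdge.lact t)) := by
  cases h with
  | cancel P a Q =>
    simpa [OEdge.flip_lact] using
      HomotopyStep.cancel (P.map (OEdge.lact t)) (a.lact t) (Q.map (OEdge.lact t))
  | cell P c Q =>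
    simpa [SqCell.path₁, SqCell.path₂, OEdge.lact, SqEdge.lact, mul_assoc] using
      HomotopyStep.cell (P.map (OEdge.lact t)) { c with left := t * c.left }
        (Q.map (OEdge.lact t))

theorem HomotopyStep.ract (t : PresT R) {P Q : List (OEdge R)} (h : HomotopyStep P Q) :
    HomotopyStep (P.map (OEdge.ract t)) (Q.map (OEdge.ract t)) := by
  cases h with
  | cancel P a Q =>
    simpa [OEdge.flip_ract] using
      HomotopyStep.cancel (P.map (OEdge.ract t)) (a.ract t) (Q.map (OEdge.ract t))
  | cell P c Q =>
    simpa [SqCell.path₁, SqCell.path₂, OEdge.ract, SqEdge.ract, mul_assoc] using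
      HomotopyStep.cell (P.map (OEdge.ract t)) { c with right := c.right * t }
        (Q.map (OEdge.ract t))

theorem revPath_append (P Q : List (OEdge R)) : revPath (P ++ Q) = revPath Q ++ revPath P := by
  simp [revPath]

theorem revPath_revPath (P : List (OEdge R)) : revPath (revPath P) = P := by
  simp [revPath, Function.comp_def, OEdge.flip_flip]

theorem revPath_lact (t : PresT R) (P : List (OEdge R)) :
    revPath (P.map (OEdge.lact t)) = (revPath P).map (OEdge.lact t) := by
  simp [revPath, Function.comp_def, OEdge.flip_lact]

theorem revPath_ract (t : PresT R) (P : List (OEdge R)) :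
    revPath (P.map (OEdge.ract t)) = (revPath P).map (OEdge.ract t) := by
  simp [revPath, Function.comp_def, OEdge.flip_ract]

end Paths

namespace SqHom

variable {X : Type*} {R : Set (IWord X × IWord X)}

/-- The homotopy class of an edge path. -/
def mk {x y : PresT R} (P : List (OEdge R)) (hP : IsPath x P y) : SqHom x y := Quot.mk _ ⟨P, hP⟩

theorem mk_congr {x y : PresT R} {P Q : List (OEdge R)} (hP : IsPath x P y) (h : P = Q) :
    mk P hP = mk Q (h ▸ hP) := by
  subst h; rfl

theorem sound {x y : PresT R} {P Q : List (OEdge R)} (hP : IsPath x P y) (hQ : IsPath x Q y)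
    (h : HomotopyStep P Q) : mk P hP = mk Q hQ := Quot.sound h

theorem mk_rev_cancel {w x y z : PresT R} (P : List (OEdge R)) (hP : IsPath x P y)
    (L₁ L₂ : List (OEdge R)) (h₁ : IsPath w L₁ y) (h₂ : IsPath y L₂ z) :
    mk (L₁ ++ revPath P ++ P ++ L₂) (((h₁.append hP.rev).append hP).append h₂) =
      mk (L₁ ++ L₂) (h₁.append h₂) := by
  induction P generalizing x with
  | nil => exact mk_congr _ (by simp [revPath])
  | cons a P ih =>
    rw [← ih hP.2]
    have e : L₁ ++ revPath (a :: P) ++ a :: P ++ L₂ =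
        (L₁ ++ revPath P) ++ [a.flip, a.flip.flip] ++ (P ++ L₂) := by
      simp [revPath, OEdge.flip_flip]
    rw [mk_congr _ e]
    refine (sound _ ?_ (HomotopyStep.cancel _ _ _)).trans (mk_congr _ (by simp))
    exact (h₁.append hP.2.rev).append (hP.2.append h₂)

/-- The identity arrow at a vertex. -/
def id (x : PresT R) : SqHom x x := mk [] rfl

/-- Composition of arrows in the fundamental groupoid, in diagrammatic order. -/
def comp {x y z : PresT R} (α : SqHom x y) (β : SqHom y z) : SqHom x z :=
  Quot.map₂ (fun P Q => ⟨P.1 ++ Q.1, P.2.append Q.2⟩)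
    (fun P _ _ h => h.append_left P.1) (fun _ _ Q h => h.append_right Q.1) α β

/-- The inverse of an arrow in the fundamental groupoid: the class of the reversed path. -/
def symm {x y : PresT R} (α : SqHom x y) : SqHom y x :=
  Quot.lift (fun P => mk (revPath P.1) P.2.rev) (by
    intro P Q h
    have h1 := mk_rev_cancel P.1 P.2 [] (revPath Q.1) rfl Q.2.rev
    have h2 := mk_rev_cancel (revPath Q.1) Q.2.rev (revPath P.1) [] P.2.rev rfl
    have e : mk ([] ++ revPath P.1 ++ P.1 ++ revPath Q.1)
          ((((show IsPath y [] y from rfl).append P.2.rev).append P.2).append Q.2.rev) =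
        mk (revPath P.1 ++ revPath (revPath Q.1) ++ revPath Q.1 ++ [])
          (((P.2.rev.append Q.2.rev.rev).append Q.2.rev).append rfl) := by
      refine sound _ _ ?_
      have := (h.append_left (revPath P.1)).append_right (revPath Q.1)
      simpa [revPath_revPath] using this
    have h3 := h1.symm.trans (e.trans h2)
    exact (mk_congr _ (by simp)).trans (h3.symm.trans (mk_congr _ (by simp)))) α

/-- The left action of `T` on the fundamental groupoid. -/
def lact (t : PresT R) {x y : PresT R} (α : SqHom x y) : SqHom (t * x) (t * y) :=
  Quot.map (fun P => ⟨P.1.map (OEdge.lact t), P.2.lact t⟩) (fun _ _ h => h.lact t) α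

/-- The right action of `T` on the fundamental groupoid. -/
def ract (t : PresT R) {x y : PresT R} (α : SqHom x y) : SqHom (x * t) (y * t) :=
  Quot.map (fun P => ⟨P.1.map (OEdge.ract t), P.2.ract t⟩) (fun _ _ h => h.ract t) α

end SqHom

/-- The fundamental groupoid `π(Sq(P), T)` as the set of all its arrows. -/
structure SqArr {X : Type*} (R : Set (IWord X × IWord X)) where
  dom : PresT R
  cod : PresT R
  hom : SqHom dom cod

namespace SqArr

variable {X : Type*} {R : Set (IWord X × IWord X)}

/-- The arrow represented by an edge path. -/
def ofPath {x y : PresT R} (P : List (OEdge R)) (hP : IsPath x P y) : SqArr R :=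
  ⟨x, y, SqHom.mk P hP⟩

/-- The arrow represented by a single edge. -/
def ofEdge (a : SqEdge R) : SqArr R :=
  ofPath (x := a.src) (y := a.tgt) [(a, true)] ⟨rfl, rfl⟩

/-- The left action `t ▷ α`. -/
def lact (t : PresT R) (α : SqArr R) : SqArr R := ⟨t * α.dom, t * α.cod, α.hom.lact t⟩

/-- The right action `α ◁ t`. -/
def ract (α : SqArr R) (t : PresT R) : SqArr R := ⟨α.dom * t, α.cod * t, α.hom.ract t⟩

/-- The groupoid inverse of an arrow. -/
def symm (α : SqArr R) : SqArr R := ⟨α.cod, α.dom, α.hom.symm⟩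

/-- The operation `α ∗ β = (α ◁ β.dom) ∘ (α.cod ▷ β)`. -/
def star (α β : SqArr R) : SqArr R :=
  ⟨α.dom * β.dom, α.cod * β.cod, (α.hom.ract β.dom).comp (β.hom.lact α.cod)⟩

theorem ofPath_congr {x y x' y' : PresT R} {P P' : List (OEdge R)} (hP : IsPath x P y)
    (hP' : IsPath x' P' y') (hx : x = x') (hy : y = y') (h : P = P') :
    ofPath P hP = ofPath P' hP' := by
  subst hx hy h; rfl

theorem exists_path (α : SqArr R) : ∃ (x y : PresT R) (P : List (OEdge R)) (hP : IsPath x P y),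
    α = ofPath P hP := by
  obtain ⟨x, y, ⟨P, hP⟩⟩ := α
  exact ⟨x, y, P, hP, rfl⟩

theorem star_assoc (α β γ : SqArr R) : (α.star β).star γ = α.star (β.star γ) := by
  obtain ⟨x, y, P, hP, rfl⟩ := α.exists_path
  obtain ⟨x', y', P', hP', rfl⟩ := β.exists_path
  obtain ⟨x'', y'', P'', hP'', rfl⟩ := γ.exists_path
  refine ofPath_congr _ _ (mul_assoc _ _ _) (mul_assoc _ _ _) ?_
  simp [ofPath, Function.comp_def, OEdge.lact_lact, OEdge.ract_ract, OEdge.ract_lact, star]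

end SqArr

/-- The idempotents `E(T)`. -/
abbrev IdemT {X : Type*} (R : Set (IWord X × IWord X)) := {e : PresT R // e * e = e}

/-- `star_e^⋈ = {e ▷ α ◁ e : α ∈ star_e}`, where `star_e` is the set of arrows with domain `e`. -/
def StarBow {X : Type*} {R : Set (IWord X × IWord X)} (e : IdemT R) : Set (SqArr R) :=
  {β | ∃ α : SqArr R, α.dom = e.1 ∧ β = (α.lact e.1).ract e.1}

namespace StarBow

variable {X : Type*} {R : Set (IWord X × IWord X)} {e : IdemT R}

theorem mem_of_path {x y : PresT R} (P : List (OEdge R)) (hP : IsPath x P y) (hx : x = e.1)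
    (hy : (e.1 * y) * e.1 = y) (h : (P.map (OEdge.lact e.1)).map (OEdge.ract e.1) = P) :
    SqArr.ofPath P hP ∈ StarBow e := by
  refine ⟨SqArr.ofPath P hP, hx, SqArr.ofPath_congr _ _ ?_ hy.symm h.symm⟩
  subst hx
  change e.1 = e.1 * e.1 * e.1
  rw [e.2, e.2]

theorem exists_path {α : SqArr R} (hα : α ∈ StarBow e) :
    ∃ (y : PresT R) (P : List (OEdge R)) (hP : IsPath e.1 P y), α = SqArr.ofPath P hP ∧
      e.1 * y = y ∧ y * e.1 = y ∧ P.map (OEdge.lact e.1) = P ∧ P.map (OEdge.ract e.1) = P := by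
  obtain ⟨β, hd, rfl⟩ := hα
  obtain ⟨x, y, P, hP, rfl⟩ := β.exists_path
  obtain rfl : x = e.1 := hd
  have hee : e.1 * e.1 * e.1 = e.1 := by rw [e.2, e.2]
  refine ⟨(e.1 * y) * e.1, (P.map (OEdge.lact e.1)).map (OEdge.ract e.1), ?_, ?_, ?_, ?_, ?_, ?_⟩
  · have := (hP.lact e.1).ract e.1
    rwa [hee] at this
  · exact SqArr.ofPath_congr _ _ hee rfl rfl
  · rw [← mul_assoc, ← mul_assoc, e.2]
  · rw [mul_assoc, e.2]
  · simp [Function.comp_def, ← OEdge.ract_lact, OEdge.lact_lact, e.2]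
  · simp [Function.comp_def, OEdge.ract_ract, e.2]

theorem cod_mul_inv {y : PresT R} {P : List (OEdge R)} (hP : IsPath e.1 P y) : y * y⁻¹ = e.1 := by
  refine psi_idem_sep (mul_inv_idem y) e.2 ?_
  rw [map_mul, psi_inv, hP.psi_eq, ← psi_inv, ← map_mul, idem_inv e.2, e.2]

theorem inv_mul_cod {y : PresT R} {P : List (OEdge R)} (hP : IsPath e.1 P y) : y⁻¹ * y = e.1 := by
  refine psi_idem_sep (inv_mul_idem y) e.2 ?_
  rw [map_mul, psi_inv, hP.psi_eq, ← psi_inv, ← map_mul, idem_inv e.2, e.2]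

/-- The group `(star_e^⋈, ∗)`. Its identity is `1_e`, and the inverse of `α` is
`α.cod⁻¹ ▷ α° ◁ α.dom⁻¹`, where `α°` is the inverse of `α` in the groupoid. -/
instance instGroup (e : IdemT R) : Group (StarBow e) where
  mul α β := ⟨α.1.star β.1, by
    obtain ⟨y, P, hP, hα, h1, h2, h3, h4⟩ := exists_path α.2
    obtain ⟨y', P', hP', hβ, h1', h2', h3', h4'⟩ := exists_path β.2
    rw [hα, hβ]
    refine mem_of_path _ ((hP.ract e.1).append (hP'.lact y)) e.2 ?_ ?_
    · rw [← mul_assoc e.1, h1, mul_assoc, h2']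
    · rw [h4, List.map_append, List.map_append, h3, h4]
      congr 1
      conv_rhs => rw [← h4', ← h1]
      simp [Function.comp_def, OEdge.lact_lact, OEdge.ract_lact]⟩
  one := ⟨SqArr.ofPath (x := e.1) [] rfl, mem_of_path _ _ rfl (by rw [e.2, e.2]) rfl⟩
  inv α := ⟨(α.1.symm.lact α.1.cod⁻¹).ract α.1.dom⁻¹, by
    obtain ⟨y, P, hP, hα, h1, h2, h3, h4⟩ := exists_path α.2
    rw [hα]
    have hey : e.1 * y⁻¹ = y⁻¹ := by
      rw [← inv_mul_cod hP, inv_mul_inv]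
    refine mem_of_path _ ((hP.rev.lact y⁻¹).ract e.1⁻¹) ?_ ?_ ?_
    · rw [inv_mul_cod hP, idem_inv e.2, e.2]
    · rw [idem_inv e.2]
      simp only [mul_assoc, e.2]
      rw [← mul_assoc, hey]
    · simp [Function.comp_def, ← OEdge.ract_lact, OEdge.lact_lact, OEdge.ract_ract, hey,
        idem_inv e.2, e.2]⟩
  mul_assoc α β γ := Subtype.ext (SqArr.star_assoc _ _ _)
  one_mul α := Subtype.ext (by
    obtain ⟨y, P, hP, hα, h1, h2, h3, h4⟩ := exists_path α.2
    change SqArr.star (SqArr.ofPath (x := e.1) [] rfl) α.1 = α.1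
    rw [hα]
    exact SqArr.ofPath_congr (((IsPath.nil e.1).ract e.1).append (hP.lact e.1)) _ e.2 h1 (by simpa using h3))
  mul_one α := Subtype.ext (by
    obtain ⟨y, P, hP, hα, h1, h2, h3, h4⟩ := exists_path α.2
    change SqArr.star α.1 (SqArr.ofPath (x := e.1) [] rfl) = α.1
    rw [hα]
    exact SqArr.ofPath_congr ((hP.ract e.1).append ((IsPath.nil e.1).lact y)) _ e.2 h2 (by simpa using h4))
  inv_mul_cancel α := Subtype.ext (by
    obtain ⟨y, P, hP, hα, h1, h2, h3, h4⟩ := exists_path α.2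
    change SqArr.star ((α.1.symm.lact α.1.cod⁻¹).ract α.1.dom⁻¹) α.1 =
      SqArr.ofPath (x := e.1) [] rfl
    rw [hα]
    have hye : y⁻¹ * e.1 = y⁻¹ := by
      rw [← cod_mul_inv hP, ← mul_assoc, inv_mul_inv]
    have h5 : (revPath P).map (OEdge.ract e.1) = revPath P := by rw [← revPath_ract, h4]
    have hQ := hP.lact y⁻¹
    rw [inv_mul_cod hP, hye] at hQ
    have hc := SqHom.mk_rev_cancel _ hQ [] [] rfl rfl
    refine (SqArr.ofPath_congr (((hP.rev.lact y⁻¹).ract e.1⁻¹).ract e.1 |>.append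
      (hP.lact (y⁻¹ * e.1 * e.1⁻¹))) ((((IsPath.nil e.1).append
        hQ.rev).append hQ).append (IsPath.nil e.1)) ?_ ?_ ?_).trans
        (congrArg (fun h => (⟨e.1, e.1, h⟩ : SqArr R)) hc)
    · rw [inv_mul_cod hP, idem_inv e.2, e.2, e.2]
    · rw [idem_inv e.2, hye, hye, inv_mul_cod hP]
    · rw [idem_inv e.2, hye, hye, revPath_lact]
      have h6 : ((revPath P).map (OEdge.lact y⁻¹)).map (OEdge.ract e.1) =
          (revPath P).map (OEdge.lact y⁻¹) := by
        conv_rhs => rw [← h5]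
        simp [Function.comp_def, OEdge.ract_lact]
      rw [h6, h6]
      simp)

end StarBow

/-! ## The generators `λ^e_{l,r,q}` and the relations -/

section Generators

variable {X : Type*} {R : Set (IWord X × IWord X)}

theorem toT_inv (w : IWord X) : toT R w.inv = (toT R w)⁻¹ := rfl

/-- The condition `e ≤ q⁻¹ (l⁻¹ l) q` under which `λ^e_{l,r,q}` is defined. -/
def LamDefined (e : IdemT R) (a : R) (q : PresT R) : Prop :=
  NatLE e.1 (q⁻¹ * toT R (a.1.1.inv * a.1.1) * q)

/-- The edge `λ^e_{l,r,q} = (e q⁻¹ l⁻¹, l, r, q e)`. -/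
def lamEdge (e : IdemT R) (a : R) (q : PresT R) : SqEdge R :=
  ⟨e.1 * q⁻¹ * toT R a.1.1.inv, a, q * e.1⟩

theorem lamEdge_src {e : IdemT R} {a : R} {q : PresT R} (h : LamDefined e a q) :
    (lamEdge e a q).src = e.1 := by
  obtain ⟨f, -, h⟩ := h
  have h0 : q⁻¹ * toT R (a.1.1.inv * a.1.1) * q = (toT R a.1.1 * q)⁻¹ * (toT R a.1.1 * q) := by
    rw [map_mul, toT_inv, mul_inv_reverse]
    simp only [mul_assoc]
  rw [h0] at h
  have h1 : (toT R a.1.1 * q)⁻¹ * (toT R a.1.1 * q) * e.1 = e.1 := by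
    conv_lhs => rw [h]
    rw [← mul_assoc, inv_mul_idem, ← h]
  calc (lamEdge e a q).src
      = e.1 * ((q⁻¹ * (toT R a.1.1)⁻¹) * (toT R a.1.1 * q) * e.1) := by
        simp only [lamEdge, SqEdge.src, toT_inv, mul_assoc]
    _ = e.1 := by rw [← mul_inv_reverse, h1, e.2]

theorem lamEdge_mem {e : IdemT R} {a : R} {q : PresT R} (h : LamDefined e a q) :
    SqArr.ofEdge (lamEdge e a q) ∈ StarBow e := by
  have h1 : e.1 * (e.1 * q⁻¹ * toT R a.1.1.inv) = e.1 * q⁻¹ * toT R a.1.1.inv := by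
    rw [← mul_assoc, ← mul_assoc, e.2]
  refine StarBow.mem_of_path _ _ (lamEdge_src h) ?_ ?_
  · simp only [SqEdge.tgt, lamEdge, mul_assoc, e.2]
    rw [← mul_assoc e.1 e.1, e.2]
  · simp only [List.map, OEdge.lact, OEdge.ract, SqEdge.lact, SqEdge.ract, lamEdge, h1]
    rw [mul_assoc q, e.2]

/-- The element `λ^e_{l,r,q}` of `star_e^⋈`: the homotopy class of the edge `λ^e_{l,r,q}`. -/
def lam (e : IdemT R) (a : R) (q : PresT R) (h : LamDefined e a q) : StarBow e :=
  ⟨SqArr.ofEdge (lamEdge e a q), lamEdge_mem h⟩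

/-- `Σ_e^⋈`: the set of homotopy classes of single edges in `star_e^⋈`. -/
def SigmaBow (e : IdemT R) : Set (StarBow e) := {α | ∃ a : SqEdge R, α.1 = SqArr.ofEdge a}

/-- `λ^e_{l,r,q}` as an element of `Σ_e^⋈`. -/
def lamSigma (e : IdemT R) (a : R) (q : PresT R) (h : LamDefined e a q) : SigmaBow e :=
  ⟨lam e a q h, lamEdge e a q, rfl⟩

/-- The relators of `λ_{l,r,vsu} ∗ λ_{s,d,u} = λ_{s,d,u} ∗ λ_{l,r,vdu}`, as elements of the free
group on the set `Σ_e^⋈`. -/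
def lamRelators (e : IdemT R) : Set (FreeGroup (SigmaBow e)) :=
  {w | ∃ (a b : R) (v u : PresT R) (h₁ : LamDefined e a (v * toT R b.1.1 * u))
    (h₂ : LamDefined e b u) (h₃ : LamDefined e a (v * toT R b.1.2 * u)),
    w = (FreeGroup.of (lamSigma e a (v * toT R b.1.1 * u) h₁) * FreeGroup.of (lamSigma e b u h₂)) *
      (FreeGroup.of (lamSigma e b u h₂) * FreeGroup.of (lamSigma e a (v * toT R b.1.2 * u) h₃))⁻¹}

/-- The set of edges (not homotopy classes) of the form `λ^e_{l,r,q}`. -/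
def LamEdges (e : IdemT R) : Set (SqEdge R) :=
  {x | ∃ (a : R) (q : PresT R), LamDefined e a q ∧ x = lamEdge e a q}

/-- The edge `λ^e_{l,r,q}` as a member of `LamEdges e`. -/
def lamSymbol (e : IdemT R) (a : R) (q : PresT R) (h : LamDefined e a q) : LamEdges e :=
  ⟨lamEdge e a q, a, q, h, rfl⟩

/-- The homotopy class in `star_e^⋈` of an edge of the form `λ^e_{l,r,q}`. -/
def lamClass (e : IdemT R) (x : LamEdges e) : StarBow e :=
  ⟨SqArr.ofEdge x.1, by obtain ⟨_, a, q, h, rfl⟩ := x; exact lamEdge_mem h⟩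

/-- The same relators, as elements of the free group on the edges `λ^e_{l,r,q}`. -/
def lamEdgeRelators (e : IdemT R) : Set (FreeGroup (LamEdges e)) :=
  {w | ∃ (a b : R) (v u : PresT R) (h₁ : LamDefined e a (v * toT R b.1.1 * u))
    (h₂ : LamDefined e b u) (h₃ : LamDefined e a (v * toT R b.1.2 * u)),
    w = (FreeGroup.of (lamSymbol e a (v * toT R b.1.1 * u) h₁) *
        FreeGroup.of (lamSymbol e b u h₂)) *
      (FreeGroup.of (lamSymbol e b u h₂) *
        FreeGroup.of (lamSymbol e a (v * toT R b.1.2 * u) h₃))⁻¹}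

end Generators

/-- The family `g` generates the group `G`, and `rels` is a set of defining relators for `G` on
the generators `g`. -/
def IsGroupPresentation {ι G : Type*} [Group G] (g : ι → G) (rels : Set (FreeGroup ι)) : Prop :=
  Subgroup.closure (Set.range g) = ⊤ ∧ (FreeGroup.lift g).ker = Subgroup.normalClosure rels

/-! The two ends of an edge have the same image under the idempotent separating map `psi`, so every
vertex `y` on a path from `e` satisfies `y * y⁻¹ = e = y⁻¹ * y`. Hence an edge with source `y` on
such a path, if fixed by `e` on both sides, can be translated back to start at `e`: it equals `y ▷
λ`, where `λ` depends only on its relation and its right factor (`lact_lamEdge`). Since `α ∗ λ = (α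
◁ e) ∘ (y ▷ λ)` for `α` ending at `y`, appending such an edge to a path fixed by `e` is right
multiplication by a generator. Thus reading a path edge by edge writes its class as a word in the
`λ` and their inverses (`ofPath_mem_closure`).

The two halves of a 2-cell translate into the two sides of a defining relation (`exists_cell`), so
the relations hold. They suffice by a universal property: given a map `f` from the edges `λ` to a
group that respects the relations, multiply its values along a path. Cancellation of inverse edges
is harmless and a 2-cell costs exactly one relation (`pathVal_homotopyStep`), so `f` extends to a
homomorphism `starLift` on the whole group. Applied with the abstractly presented group as target,
this gives the inverse of the canonical map, for edges and for homotopy classes alike. -/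

section StarBowPresentation

variable {X : Type*} {R : Set (IWord X × IWord X)} {e : IdemT R}

/-! ### Vertices over `psi R e` and normal forms of edges -/

/-- Both idempotents have the same image in `M`, and `psi` separates idempotents. -/
theorem mul_inv_of_psi_eq {y : PresT R} (h : psi R y = psi R e.1) : y * y⁻¹ = e.1 := by
  refine psi_idem_sep (mul_inv_idem y) e.2 ?_
  rw [map_mul, psi_inv, h, ← psi_inv, ← map_mul, idem_inv e.2, e.2]

theorem inv_mul_of_psi_eq {y : PresT R} (h : psi R y = psi R e.1) : y⁻¹ * y = e.1 := by
  refine psi_idem_sep (inv_mul_idem y) e.2 ?_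
  rw [map_mul, psi_inv, h, ← psi_inv, ← map_mul, idem_inv e.2, e.2]

theorem SqEdge.psi_tgt (x : SqEdge R) : psi R x.tgt = psi R x.src :=
  OEdge.psi_tgt (x, true)

/-- An edge whose source has the same image in `M` as `e` has a normalized form `λ^e`. -/
theorem lamDefined_of_psi_src {x : SqEdge R} (h : psi R x.src = psi R e.1) :
    LamDefined e x.rel x.right := by
  have h0 := inv_mul_of_psi_eq h
  refine ⟨e.1, e.2, ?_⟩
  have h1 : x.right⁻¹ * toT R (x.rel.1.1.inv * x.rel.1.1) * x.right =
      (toT R x.rel.1.1 * x.right)⁻¹ * (toT R x.rel.1.1 * x.right) := by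
    rw [map_mul, toT_inv, mul_inv_reverse]
    simp only [mul_assoc]
  -- With `Y = l * q`, the claim becomes `e = e * (Y⁻¹ * Y)`. It holds because `e = x.src⁻¹ *
  -- x.src`, the source ends in the factor `Y`, and `Y * Y⁻¹ * Y = Y`.
  rw [h1, idem_comm (inv_mul_idem _) e.2]
  have h2 : x.src = x.left * (toT R x.rel.1.1 * x.right) := mul_assoc _ _ _
  conv_rhs => rw [← h0]
  rw [mul_assoc x.src⁻¹]
  conv_rhs => enter [2, 1]; rw [h2]
  rw [mul_assoc x.left, ← mul_assoc (toT R x.rel.1.1 * x.right), mul_inv_mul, ← h2, h0]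

/-- Every edge fixed by `e` on both sides is a left translate of an edge `λ^e`. -/
theorem lact_lamEdge {x : SqEdge R} (hl : e.1 * x.left = x.left) (hr : x.right * e.1 = x.right)
    (h : psi R x.src = psi R e.1) : (lamEdge e x.rel x.right).lact x.src = x := by
  have h0 := mul_inv_of_psi_eq h
  have h2 : x.src = x.left * (toT R x.rel.1.1 * x.right) := mul_assoc _ _ _
  refine SqEdge.ext ?_ rfl hr
  generalize hX : toT R x.rel.1.1 * x.right = Y at h2
  have hYe : Y * e.1 = Y := by rw [← hX, mul_assoc, hr]
  have hYi : x.right⁻¹ * toT R x.rel.1.1.inv = Y⁻¹ := by rw [← hX, mul_inv_reverse, toT_inv]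
  change x.src * (e.1 * x.right⁻¹ * toT R x.rel.1.1.inv) = x.left
  -- The right factor absorbs `e`, leaving `p * (Y * Y⁻¹)` with `p = x.left`. Commuting `Y * Y⁻¹`
  -- past `p⁻¹ * p` turns this into `(p * Y) * (p * Y)⁻¹ * p`, and `p * Y` is the source, so the
  -- result is `e * p = p`.
  calc x.src * (e.1 * x.right⁻¹ * toT R x.rel.1.1.inv)
      = x.left * (Y * e.1) * (x.right⁻¹ * toT R x.rel.1.1.inv) := by
        rw [h2]; simp only [mul_assoc]
    _ = (x.left * x.left⁻¹ * x.left) * (Y * Y⁻¹) := by rw [hYe, hYi, mul_inv_mul, mul_assoc]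
    _ = x.left * ((x.left⁻¹ * x.left) * (Y * Y⁻¹)) := by simp only [mul_assoc]
    _ = x.left * ((Y * Y⁻¹) * (x.left⁻¹ * x.left)) := by
        rw [idem_comm (inv_mul_idem _) (mul_inv_idem _)]
    _ = (x.left * Y) * (x.left * Y)⁻¹ * x.left := by
        rw [mul_inv_reverse]; simp only [mul_assoc]
    _ = x.left := by rw [← h2, h0, hl]

/-- The case of `lact_lamEdge` in which the translation is by `e`, which the left factor of
`lamEdge` already absorbs. -/
theorem eq_lamEdge {x : SqEdge R} (hl : e.1 * x.left = x.left) (hr : x.right * e.1 = x.right)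
    (h : x.src = e.1) : x = lamEdge e x.rel x.right := by
  have h1 := lact_lamEdge hl hr (by rw [h])
  rw [h] at h1
  refine h1.symm.trans (SqEdge.ext ?_ rfl rfl)
  simp only [lamEdge, SqEdge.lact]
  rw [← mul_assoc, ← mul_assoc, e.2]

/-- Along a path from a vertex with the same image in `M` as `e`, every edge is normalizable. -/
theorem IsPath.lamDefined {x y : PresT R} {P : List (OEdge R)} (hP : IsPath x P y)
    (h : psi R x = psi R e.1) : ∀ a ∈ P, LamDefined e a.1.rel a.1.right := by
  induction P generalizing x with
  | nil => simp
  | cons a P ih =>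
    have ha : psi R a.src = psi R e.1 := by rw [hP.1, h]
    intro b hb
    rcases List.mem_cons.1 hb with rfl | hb
    · refine lamDefined_of_psi_src ?_
      rcases b with ⟨b, _ | _⟩
      · rw [← SqEdge.psi_tgt]; exact ha
      · exact ha
    · exact ih hP.2 (by rw [OEdge.psi_tgt, ha]) b hb

/-! ### Classes of single edges -/

theorem StarBow.psi_dom (α : StarBow e) : psi R α.1.dom = psi R e.1 := by
  obtain ⟨y, P, hP, hα, -⟩ := StarBow.exists_path α.2
  rw [hα]; rfl

/-- An edge that represents an element of the group need not itself be fixed by `e`; only its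
homotopy class is. Multiplying the edge by `e` on both sides keeps the class and makes the edge
literally some `λ^e`. -/
theorem mem_sigmaBow_iff (α : StarBow e) : α ∈ SigmaBow e ↔
    ∃ (a : R) (q : PresT R) (h : LamDefined e a q), α = lam e a q h := by
  constructor
  · rintro ⟨x, hx⟩
    obtain ⟨β, hβ, hα⟩ := α.2
    have hxe : x.src = e.1 := by
      have h1 : x.src = α.1.dom := by rw [hx]; rfl
      rw [h1, hα]
      change e.1 * β.dom * e.1 = e.1
      rw [hβ, e.2, e.2]
    have hfix : α.1 = (α.1.lact e.1).ract e.1 := by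
      obtain ⟨y, P, hP, hα, h1, h2, h3, h4⟩ := StarBow.exists_path α.2
      rw [hα]
      refine SqArr.ofPath_congr hP ((hP.lact e.1).ract e.1) ?_ ?_ ?_
      · rw [e.2, e.2]
      · rw [h1, h2]
      · rw [h3, h4]
    let z : SqEdge R := (x.lact e.1).ract e.1
    have hz : z.src = e.1 := by
      have h1 : z.src = e.1 * x.src * e.1 := by
        simp only [z, SqEdge.src, SqEdge.lact, SqEdge.ract, mul_assoc]
      rw [h1, hxe, e.2, e.2]
    have hzl : z = lamEdge e z.rel z.right := by
      refine eq_lamEdge ?_ ?_ hz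
      · change e.1 * (e.1 * x.left) = e.1 * x.left
        rw [← mul_assoc, e.2]
      · change x.right * e.1 * e.1 = x.right * e.1
        rw [mul_assoc, e.2]
    refine ⟨z.rel, z.right, lamDefined_of_psi_src (by rw [hz]), Subtype.ext ?_⟩
    change α.1 = SqArr.ofEdge (lamEdge e z.rel z.right)
    rw [← hzl, hfix, hx]
    refine SqArr.ofPath_congr (((show IsPath x.src [(x, true)] x.tgt from
      ⟨rfl, rfl⟩).lact e.1).ract e.1) _ ?_ ?_ rfl
    · simp only [z, SqEdge.src, SqEdge.lact, SqEdge.ract, mul_assoc]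
    · simp only [z, SqEdge.tgt, SqEdge.lact, SqEdge.ract, mul_assoc]
  · rintro ⟨a, q, h, rfl⟩
    exact ⟨_, rfl⟩

/-! ### The defining relations and 2-cells -/

/-- Both sides of a defining relation bound the same 2-cell. -/
theorem exists_cell (a b : R) (v u : PresT R) (h₁ : LamDefined e a (v * toT R b.1.1 * u))
    (h₂ : LamDefined e b u) (h₃ : LamDefined e a (v * toT R b.1.2 * u)) :
    ∃ (c : SqCell R) (y : PresT R) (p₁ : IsPath e.1 c.path₁ y) (p₂ : IsPath e.1 c.path₂ y),
      c.rel₁ = a ∧ c.rel₂ = b ∧ c.mid = v ∧ c.right = u * e.1 ∧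
      (lam e a (v * toT R b.1.1 * u) h₁ * lam e b u h₂).1 = SqArr.ofPath c.path₁ p₁ ∧
      (lam e b u h₂ * lam e a (v * toT R b.1.2 * u) h₃).1 = SqArr.ofPath c.path₂ p₂ := by
  -- The left factor of `λ^e_{l,r,vsu}`, which makes the first edge `x₁` of the cell equal to that
  -- generator. The edge `x₃` also starts at `e`, so it is a generator too; `x₂` and `x₄` are
  -- translates of generators to the ends of `x₁` and `x₃`.
  let p : PresT R := e.1 * (v * toT R b.1.1 * u)⁻¹ * toT R a.1.1.inv
  let c : SqCell R := ⟨p, a, v, b, u * e.1⟩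
  have hep : e.1 * p = p := by
    simp only [p]
    rw [← mul_assoc, ← mul_assoc, e.2]
  have hu : u * e.1 * e.1 = u * e.1 := by rw [mul_assoc, e.2]
  let x₁ : SqEdge R := ⟨p, a, v * toT R b.1.1 * (u * e.1)⟩
  let x₂ : SqEdge R := ⟨p * toT R a.1.2 * v, b, u * e.1⟩
  let x₃ : SqEdge R := ⟨p * toT R a.1.1 * v, b, u * e.1⟩
  let x₄ : SqEdge R := ⟨p, a, v * toT R b.1.2 * (u * e.1)⟩
  have e₁ : x₁ = lamEdge e a (v * toT R b.1.1 * u) := SqEdge.ext rfl rfl (mul_assoc _ _ _).symm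
  have s₁ : x₁.src = e.1 := by rw [e₁]; exact lamEdge_src h₁
  have s₂ : x₂.src = x₁.tgt := by simp only [x₁, x₂, SqEdge.src, SqEdge.tgt, mul_assoc]
  have s₃ : x₃.src = e.1 := by rw [← s₁]; simp only [x₁, x₃, SqEdge.src, mul_assoc]
  have s₄ : x₄.src = x₃.tgt := by simp only [x₃, x₄, SqEdge.src, SqEdge.tgt, mul_assoc]
  have t₄ : x₄.tgt = x₂.tgt := by simp only [x₂, x₄, SqEdge.tgt, mul_assoc]
  -- The edges of the cell have right factor ending in `e`, so normalizing them produces `q * e`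
  -- where the relation has `q`.
  have lam_mul : ∀ (a : R) (q : PresT R), lamEdge e a (q * e.1) = lamEdge e a q := by
    intro a q
    refine SqEdge.ext ?_ rfl ?_
    · simp only [lamEdge]
      rw [mul_inv_reverse, idem_inv e.2, ← mul_assoc e.1, e.2]
    · simp only [lamEdge]
      rw [mul_assoc, e.2]
  have e₃ : x₃ = lamEdge e b u := by
    refine (eq_lamEdge (e := e) ?_ hu s₃).trans (lam_mul b u)
    simp only [x₃, ← mul_assoc, hep]
  have e₂ : x₂ = (lamEdge e b u).lact x₁.tgt := by
    rw [← lam_mul, ← s₂]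
    refine (lact_lamEdge (x := x₂) ?_ hu ?_).symm
    · simp only [x₂, ← mul_assoc, hep]
    · rw [s₂, SqEdge.psi_tgt, s₁]
  have e₄ : x₄ = (lamEdge e a (v * toT R b.1.2 * u)).lact x₃.tgt := by
    rw [← lam_mul, ← s₄, mul_assoc _ u]
    refine (lact_lamEdge (x := x₄) hep ?_ ?_).symm
    · simp only [x₄]
      rw [mul_assoc, hu]
    · rw [s₄, SqEdge.psi_tgt, s₃]
  have ract_lam : ∀ (a : R) (q : PresT R), (lamEdge e a q).ract e.1 = lamEdge e a q := by
    intro a q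
    refine SqEdge.ext rfl rfl ?_
    simp only [lamEdge, SqEdge.ract]
    rw [mul_assoc, e.2]
  have star_lam : ∀ (y z : SqEdge R) (w : SqEdge R), y.ract e.1 = y → y.src = e.1 →
      z.src = e.1 → w = z.lact y.tgt → ∀ hp : IsPath e.1 [(y, true), (w, true)] w.tgt,
      (SqArr.ofEdge y).star (SqArr.ofEdge z) = SqArr.ofPath [(y, true), (w, true)] hp := by
    intro y z w hy hys hzs hw hp
    refine SqArr.ofPath_congr (((show IsPath y.src [(y, true)] y.tgt from
      ⟨rfl, rfl⟩).ract z.src).append ((show IsPath z.src [(z, true)] z.tgt from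
      ⟨rfl, rfl⟩).lact y.tgt)) hp ?_ ?_ ?_
    · rw [hys, hzs, e.2]
    · rw [hw]; exact (OEdge.tgt_lact y.tgt (z, true)).symm
    · simp only [List.map_cons, List.map_nil, List.cons_append, List.nil_append, OEdge.ract,
        OEdge.lact, hzs, hy, hw]
  have p₁ : IsPath e.1 [(x₁, true), (x₂, true)] x₂.tgt := ⟨s₁, s₂, rfl⟩
  have p₂ : IsPath e.1 [(x₃, true), (x₄, true)] x₄.tgt := ⟨s₃, s₄, rfl⟩
  refine ⟨c, x₂.tgt, p₁, t₄ ▸ p₂, rfl, rfl, rfl, rfl, ?_, ?_⟩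
  · refine Eq.trans ?_ (star_lam x₁ (lamEdge e b u) x₂ ?_ s₁ (lamEdge_src h₂) e₂ p₁)
    · rw [e₁]; rfl
    · rw [e₁, ract_lam]
  · refine Eq.trans ?_ ((star_lam x₃ (lamEdge e a _) x₄ ?_ s₃ (lamEdge_src h₃) e₄ p₂).trans
      (SqArr.ofPath_congr _ _ rfl t₄ rfl))
    · rw [e₃]; rfl
    · rw [e₃, ract_lam]

theorem lam_mul_comm (a b : R) (v u : PresT R) (h₁ : LamDefined e a (v * toT R b.1.1 * u))
    (h₂ : LamDefined e b u) (h₃ : LamDefined e a (v * toT R b.1.2 * u)) :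
    lam e a (v * toT R b.1.1 * u) h₁ * lam e b u h₂ =
      lam e b u h₂ * lam e a (v * toT R b.1.2 * u) h₃ := by
  obtain ⟨c, y, p₁, p₂, -, -, -, -, hc₁, hc₂⟩ := exists_cell a b v u h₁ h₂ h₃
  refine Subtype.ext (hc₁.trans (Eq.trans ?_ hc₂.symm))
  have h : HomotopyStep c.path₁ c.path₂ := by simpa using HomotopyStep.cell [] c []
  exact congrArg (fun h => (⟨e.1, y, h⟩ : SqArr R)) (SqHom.sound p₁ p₂ h)

/-! ### Generation -/

theorem ofPath_mem_closure (P : List (OEdge R)) {y : PresT R} (hP : IsPath e.1 P y)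
    (hl : P.map (OEdge.lact e.1) = P) (hr : P.map (OEdge.ract e.1) = P)
    (hm : SqArr.ofPath P hP ∈ StarBow e) :
    (⟨SqArr.ofPath P hP, hm⟩ : StarBow e) ∈ Subgroup.closure (Set.range (lamClass e)) := by
  -- Appending a forward edge to a path fixed on the right by `e` is right multiplication by the
  -- normal form of that edge.
  have key : ∀ (P : List (OEdge R)) (x : SqEdge R) (hP : IsPath e.1 P x.src)
      (hP' : IsPath e.1 (P ++ [(x, true)]) x.tgt), P.map (OEdge.ract e.1) = P →
      e.1 * x.left = x.left → x.right * e.1 = x.right →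
      ∀ (hm : SqArr.ofPath P hP ∈ StarBow e) (hm' : SqArr.ofPath _ hP' ∈ StarBow e),
      ∃ s : LamEdges e, (⟨SqArr.ofPath _ hP', hm'⟩ : StarBow e) =
        ⟨SqArr.ofPath P hP, hm⟩ * lamClass e s := by
    intro P x hP hP' hPr hxl hxr hm hm'
    have hψ : psi R x.src = psi R e.1 := hP.psi_eq
    have hd := lamDefined_of_psi_src hψ
    have hx := lact_lamEdge hxl hxr hψ
    refine ⟨lamSymbol e x.rel x.right hd, Subtype.ext ?_⟩
    have hs := lamEdge_src hd
    refine SqArr.ofPath_congr hP' ((hP.ract (lamEdge e x.rel x.right).src).append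
      ((show IsPath (lamEdge e x.rel x.right).src [(lamEdge e x.rel x.right, true)]
        (lamEdge e x.rel x.right).tgt from ⟨rfl, rfl⟩).lact x.src)) ?_ ?_ ?_
    · rw [hs, e.2]
    · conv_lhs => rw [← hx]
      exact OEdge.tgt_lact x.src (lamEdge e x.rel x.right, true)
    · simp only [hs, hPr, List.map_cons, List.map_nil, OEdge.lact, hx]
  have mem : ∀ (P : List (OEdge R)) {y : PresT R} (hP : IsPath e.1 P y),
      P.map (OEdge.lact e.1) = P → P.map (OEdge.ract e.1) = P → e.1 * y * e.1 = y →
      SqArr.ofPath P hP ∈ StarBow e := by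
    intro P y hP hl hr hy
    exact StarBow.mem_of_path P hP rfl hy (by rw [hl, hr])
  have split : ∀ (P Q : List (OEdge R)) {x y : PresT R}, IsPath x (P ++ Q) y →
      ∃ z, IsPath x P z ∧ IsPath z Q y := by
    intro P Q
    induction P with
    | nil => intro x y h; exact ⟨x, rfl, h⟩
    | cons a P ih =>
      intro x y h
      obtain ⟨z, h1, h2⟩ := ih h.2
      exact ⟨z, ⟨h.1, h1⟩, h2⟩
  induction P using List.reverseRecOn generalizing y with
  | nil =>
    obtain rfl : e.1 = y := hP
    exact one_mem _
  | append_singleton P a ih =>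
    obtain ⟨z, hPz, ha⟩ := split P [a] hP
    simp only [List.map_append, List.map_cons, List.map_nil] at hl hr
    obtain ⟨hPl, hal⟩ := List.append_inj' hl rfl
    obtain ⟨hPr, har⟩ := List.append_inj' hr rfl
    have hal : a.lact e.1 = a := by simpa using hal
    have har : a.ract e.1 = a := by simpa using har
    -- The intermediate vertex is fixed by `e` because it is the source of a fixed edge; so the
    -- prefix again represents an element of the group and the induction applies.
    have hz : e.1 * z * e.1 = z := by
      rw [← ha.1]
      rw [← OEdge.src_lact, hal, ← OEdge.src_ract, har]
    have hmP := mem P hPz hPl hPr hz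
    have ihP := ih hPz hPl hPr hmP
    have hxl : e.1 * a.1.left = a.1.left := congrArg (fun b : OEdge R => b.1.left) hal
    have hxr : a.1.right * e.1 = a.1.right := congrArg (fun b : OEdge R => b.1.right) har
    obtain ⟨x, o⟩ := a
    cases o with
    | true =>
      obtain ⟨hz1, hy1⟩ := ha
      change x.src = z at hz1
      change x.tgt = y at hy1
      subst hz1 hy1
      obtain ⟨s, hs⟩ := key P x hPz hP hPr hxl hxr hmP hm
      rw [hs]
      exact mul_mem ihP (Subgroup.subset_closure ⟨s, rfl⟩)
    | false =>
      obtain ⟨hz1, hy1⟩ := ha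
      change x.tgt = z at hz1
      change x.src = y at hy1
      subst hz1 hy1
      -- For a backward edge, traverse it forwards again: the class of `P` is then the class sought
      -- times a generator, and one solves for the latter.
      have hP2 : IsPath e.1 ((P ++ [(x, false)]) ++ [(x, true)]) x.tgt := hP.append ⟨rfl, rfl⟩
      have heq : SqArr.ofPath _ hP2 = SqArr.ofPath P hPz := by
        have hst : HomotopyStep ((P ++ [(x, false)]) ++ [(x, true)]) P := by
          simpa [OEdge.flip] using HomotopyStep.cancel P (x, false) []
        exact congrArg (fun h => (⟨e.1, x.tgt, h⟩ : SqArr R)) (SqHom.sound hP2 hPz hst)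
      obtain ⟨s, hs⟩ := key (P ++ [(x, false)]) x hP hP2
        (by simp only [List.map_append, List.map_cons, List.map_nil, hPr, har]) hxl hxr hm
        (heq ▸ hmP)
      have hs' : (⟨SqArr.ofPath P hPz, hmP⟩ : StarBow e) =
          ⟨SqArr.ofPath _ hP, hm⟩ * lamClass e s := by
        rw [← hs]; exact Subtype.ext heq.symm
      rw [← mul_inv_eq_of_eq_mul hs']
      exact mul_mem ihP (inv_mem (Subgroup.subset_closure ⟨s, rfl⟩))

theorem closure_range_lamClass : Subgroup.closure (Set.range (lamClass e)) = ⊤ := by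
  refine (Subgroup.eq_top_iff' _).2 fun α => ?_
  obtain ⟨α, hα⟩ := α
  obtain ⟨y, P, hP, rfl, -, -, h3, h4⟩ := StarBow.exists_path hα
  exact ofPath_mem_closure P hP h3 h4 hα

/-! ### Extending maps on the edges `λ^e` to the group -/

section Lift

variable {H : Type*} [Group H] (f : LamEdges e → H)

open Classical in
/-- The value of the normalization of an edge under `f`. -/
noncomputable def edgeVal (x : SqEdge R) : H :=
  if h : lamEdge e x.rel x.right ∈ LamEdges e then f ⟨_, h⟩ else 1

theorem edgeVal_eq {x : SqEdge R} (h : LamDefined e x.rel x.right) :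
    edgeVal f x = f (lamSymbol e x.rel x.right h) :=
  dif_pos (⟨x.rel, x.right, h, rfl⟩ : lamEdge e x.rel x.right ∈ LamEdges e)

/-- The value of an edge path under `f`. -/
noncomputable def pathVal (P : List (OEdge R)) : H :=
  (P.map fun a => if a.2 then edgeVal f a.1 else (edgeVal f a.1)⁻¹).prod

theorem pathVal_append (P Q : List (OEdge R)) :
    pathVal f (P ++ Q) = pathVal f P * pathVal f Q := by
  simp [pathVal]

/-- The normal form of an edge ignores its left factor. -/
theorem pathVal_lact (t : PresT R) (P : List (OEdge R)) :
    pathVal f (P.map (OEdge.lact t)) = pathVal f P := by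
  simp only [pathVal, List.map_map]
  rfl

/-- `f` respects the relations `λ_{l,r,vsu} λ_{s,d,u} = λ_{s,d,u} λ_{l,r,vdu}`. -/
def RespectsLam : Prop :=
  ∀ (a b : R) (v u : PresT R) (h₁ : LamDefined e a (v * toT R b.1.1 * u))
    (h₂ : LamDefined e b u) (h₃ : LamDefined e a (v * toT R b.1.2 * u)),
    f (lamSymbol e a (v * toT R b.1.1 * u) h₁) * f (lamSymbol e b u h₂) =
      f (lamSymbol e b u h₂) * f (lamSymbol e a (v * toT R b.1.2 * u) h₃)

variable {f}

/-- The hypothesis on `x` makes all edges of both paths normalizable, so that the values across a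
2-cell are genuine values of `f`, to which a defining relation applies. -/
theorem pathVal_homotopyStep (hf : RespectsLam f) {x y : PresT R} {P Q : List (OEdge R)}
    (hx : psi R x = psi R e.1) (hP : IsPath x P y) (hQ : IsPath x Q y) (h : HomotopyStep P Q) :
    pathVal f P = pathVal f Q := by
  cases h with
  | cancel P a Q =>
    simp only [pathVal_append]
    have : pathVal f [a, a.flip] = 1 := by
      rcases a with ⟨a, _ | _⟩ <;> simp [pathVal, OEdge.flip]
    rw [this, mul_one]
  | cell P c Q =>
    simp only [pathVal_append]
    congr 2
    have h1 := hP.lamDefined hx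
    have h2 := hQ.lamDefined hx
    have d₁ : LamDefined e c.rel₁ (c.mid * toT R c.rel₂.1.1 * c.right) :=
      h1 (⟨c.left, c.rel₁, c.mid * toT R c.rel₂.1.1 * c.right⟩, true) (by simp [SqCell.path₁])
    have d₂ : LamDefined e c.rel₂ c.right :=
      h1 (⟨c.left * toT R c.rel₁.1.2 * c.mid, c.rel₂, c.right⟩, true) (by simp [SqCell.path₁])
    have d₃ : LamDefined e c.rel₁ (c.mid * toT R c.rel₂.1.2 * c.right) :=
      h2 (⟨c.left, c.rel₁, c.mid * toT R c.rel₂.1.2 * c.right⟩, true) (by simp [SqCell.path₂])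
    -- The two edges of the cell that carry the second relation differ only in their left factors
    -- and so have the same value; three values remain, as in the relation.
    have := hf _ _ _ _ d₁ d₂ d₃
    simpa only [pathVal, SqCell.path₁, SqCell.path₂, List.map_cons, List.map_nil, List.prod_cons,
      List.prod_nil, mul_one, if_true,
      edgeVal_eq f (x := ⟨c.left, c.rel₁, c.mid * toT R c.rel₂.1.1 * c.right⟩) d₁,
      edgeVal_eq f (x := ⟨c.left * toT R c.rel₁.1.2 * c.mid, c.rel₂, c.right⟩) d₂,
      edgeVal_eq f (x := ⟨c.left * toT R c.rel₁.1.1 * c.mid, c.rel₂, c.right⟩) d₂,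
      edgeVal_eq f (x := ⟨c.left, c.rel₁, c.mid * toT R c.rel₂.1.2 * c.right⟩) d₃] using this

/-- The value under `f` of an arrow of the fundamental groupoid. -/
noncomputable def homVal (hf : RespectsLam f) {x y : PresT R} (hx : psi R x = psi R e.1)
    (α : SqHom x y) : H :=
  Quot.lift (fun P : {P : List (OEdge R) // IsPath x P y} => pathVal f P.1)
    (fun P Q h => pathVal_homotopyStep hf hx P.2 Q.2 h) α

/-- A map on the edges `λ^e` that respects the relations extends to `star_e^⋈`. -/
noncomputable def starLift (hf : RespectsLam f) : StarBow e →* H :=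
  MonoidHom.mk' (fun α => homVal hf (StarBow.psi_dom α) α.1.hom) (by
    rintro ⟨α, hα⟩ ⟨β, hβ⟩
    obtain ⟨y, P, hP, rfl, h1, h2, h3, h4⟩ := StarBow.exists_path hα
    obtain ⟨y', P', hP', rfl, h1', h2', h3', h4'⟩ := StarBow.exists_path hβ
    change pathVal f (P.map (OEdge.ract e.1) ++ P'.map (OEdge.lact y)) =
      pathVal f P * pathVal f P'
    -- In `α ∗ β` the right action by `e` fixes the path of `α`, and the left translation of the
    -- path of `β` does not affect its value.
    rw [pathVal_append, pathVal_lact, h4])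

/-- An edge `λ^e` is its own normal form. -/
theorem starLift_lamClass (hf : RespectsLam f) (s : LamEdges e) :
    starLift hf (lamClass e s) = f s := by
  obtain ⟨x, a, q, h, rfl⟩ := s
  change pathVal f [(lamEdge e a q, true)] = _
  simp only [pathVal, List.map_cons, List.map_nil, List.prod_cons, List.prod_nil, mul_one, if_true]
  have hd : LamDefined e (lamEdge e a q).rel (lamEdge e a q).right :=
    lamDefined_of_psi_src (by rw [lamEdge_src h])
  rw [edgeVal_eq f hd]
  congr 1
  refine Subtype.ext (eq_lamEdge ?_ ?_ (lamEdge_src h)).symm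
  · simp only [lamEdge]
    rw [← mul_assoc, ← mul_assoc, e.2]
  · simp only [lamEdge]
    rw [mul_assoc, e.2]

end Lift

/-! ### The two presentations -/

/-- If the relators hold in `G` and the map from generators to the presented group extends to a
homomorphism on `G`, then the relators are defining. -/
theorem FreeGroup.ker_lift_eq_normalClosure {ι G : Type*} [Group G] {g : ι → G}
    {rels : Set (FreeGroup ι)} (hrels : ∀ w ∈ rels, FreeGroup.lift g w = 1)
    (φ : G →* FreeGroup ι ⧸ Subgroup.normalClosure rels)
    (hφ : ∀ i, φ (g i) = QuotientGroup.mk' _ (FreeGroup.of i)) :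
    (FreeGroup.lift g).ker = Subgroup.normalClosure rels := by
  refine le_antisymm (fun w hw => ?_) (Subgroup.normalClosure_le_normal hrels)
  -- The two homomorphisms agree on generators. Thus a word trivial in `G` is trivial in the
  -- presented group.
  have h : φ.comp (FreeGroup.lift g) = QuotientGroup.mk' (Subgroup.normalClosure rels) :=
    FreeGroup.ext_hom _ _ fun i => by simpa using hφ i
  rw [← QuotientGroup.ker_mk' (Subgroup.normalClosure rels), ← h, MonoidHom.mem_ker,
    MonoidHom.comp_apply, MonoidHom.mem_ker.1 hw, φ.map_one]

theorem lamEdgeRelators_presentation :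
    IsGroupPresentation (lamClass e) (lamEdgeRelators e) := by
  refine ⟨closure_range_lamClass, ?_⟩
  have hf : RespectsLam fun s : LamEdges e =>
      QuotientGroup.mk' (Subgroup.normalClosure (lamEdgeRelators e)) (FreeGroup.of s) := by
    intro a b v u h₁ h₂ h₃
    rw [← map_mul, ← map_mul, ← mul_inv_eq_one, ← map_inv, ← map_mul]
    exact (QuotientGroup.eq_one_iff _).2
      (Subgroup.subset_normalClosure ⟨a, b, v, u, h₁, h₂, h₃, rfl⟩)
  refine FreeGroup.ker_lift_eq_normalClosure ?_ (starLift hf) (starLift_lamClass hf)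
  rintro w ⟨a, b, v, u, h₁, h₂, h₃, rfl⟩
  simp only [map_mul, map_inv, FreeGroup.lift_apply_of]
  exact mul_inv_eq_one.2 (lam_mul_comm a b v u h₁ h₂ h₃)

/-- Sending an edge to the generator of its homotopy class respects the relations, so the extension
from edges applies here too. That it has the right value on every generator uses `mem_sigmaBow_iff`:
each class in `SigmaBow e` contains some `λ^e`. -/
theorem lamRelators_presentation :
    IsGroupPresentation (Subtype.val : SigmaBow e → StarBow e) (lamRelators e) := by
  refine ⟨?_, ?_⟩
  · refine top_unique (closure_range_lamClass.symm.le.trans (Subgroup.closure_mono ?_))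
    rintro _ ⟨s, rfl⟩
    exact ⟨⟨lamClass e s, s.1, rfl⟩, rfl⟩
  have hf : RespectsLam fun s : LamEdges e =>
      QuotientGroup.mk' (Subgroup.normalClosure (lamRelators e))
        (FreeGroup.of (⟨lamClass e s, s.1, rfl⟩ : SigmaBow e)) := by
    intro a b v u h₁ h₂ h₃
    rw [← map_mul, ← map_mul, ← mul_inv_eq_one, ← map_inv, ← map_mul]
    exact (QuotientGroup.eq_one_iff _).2
      (Subgroup.subset_normalClosure ⟨a, b, v, u, h₁, h₂, h₃, rfl⟩)
  refine FreeGroup.ker_lift_eq_normalClosure ?_ (starLift hf) ?_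
  · rintro w ⟨a, b, v, u, h₁, h₂, h₃, rfl⟩
    simp only [map_mul, map_inv, FreeGroup.lift_apply_of]
    exact mul_inv_eq_one.2 (lam_mul_comm a b v u h₁ h₂ h₃)
  · rintro ⟨α, hα⟩
    obtain ⟨a, q, h, rfl⟩ := (mem_sigmaBow_iff α).1 hα
    exact starLift_lamClass hf (lamSymbol e a q h)

end StarBowPresentation

theorem mainTheorem7 {X : Type*} (R : Set (IWord X × IWord X)) (e : IdemT R) :
    -- the classes of single edges in `star_e^⋈` are exactly the `λ^e_{l,r,q}`
    (∀ α : StarBow e, α ∈ SigmaBow e ↔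
      ∃ (a : R) (q : PresT R) (h : LamDefined e a q), α = lam e a q h) ∧
    -- presentation of `(star_e^⋈, ∗)` on the set `Σ_e^⋈` of classes of single edges
    IsGroupPresentation (Subtype.val : SigmaBow e → StarBow e) (lamRelators e) ∧
    -- the same with one generator for each edge `λ^e_{l,r,q}`
    IsGroupPresentation (lamClass e) (lamEdgeRelators e) ∧
    -- the two sides of each relation are the two halves of the boundary of a 2-cell
    (∀ (a b : R) (v u : PresT R) (h₁ : LamDefined e a (v * toT R b.1.1 * u))
      (h₂ : LamDefined e b u) (h₃ : LamDefined e a (v * toT R b.1.2 * u)),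
      ∃ (c : SqCell R) (y : PresT R) (p₁ : IsPath e.1 c.path₁ y) (p₂ : IsPath e.1 c.path₂ y),
        c.rel₁ = a ∧ c.rel₂ = b ∧ c.mid = v ∧ c.right = u * e.1 ∧
        (lam e a (v * toT R b.1.1 * u) h₁ * lam e b u h₂).1 = SqArr.ofPath c.path₁ p₁ ∧
        (lam e b u h₂ * lam e a (v * toT R b.1.2 * u) h₃).1 = SqArr.ofPath c.path₂ p₂) :=
  ⟨mem_sigmaBow_iff, lamRelators_presentation, lamEdgeRelators_presentation, exists_cell⟩
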